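/- \textbf{Definitions.} A multi-tape Turing machine with a non-deterministic oracle is a multi-tape Turing machine (finitely many tapes, states and symbols) some of whose states are query states: a step from a query state consumes one oracle bit, and the transition may depend on that bit. For $f:\mathbb N\to\mathbb N$ and $g:\mathbb N\to\mathbb R$, let $NDTIME(f(n),g(n))$ be the class of languages $L\subseteq\{0,1\}^*$ for which there is such a machine that, on every input $x$ of length $n$ and for all oracle answers, halts with acceptance or rejection within $O(g(n))$ steps and consumes at most $f(n)$ oracle bits, and such that $x\in L$ if and only if the machine accepts $x$ for some sequence of oracle answers. Let $DTIME(g(n))=NDTIME(0,g(n))$. The problem $3SAT(\ell)$ is to decide the satisfiability of a Boolean formula in conjunctive normal form with $\ell$ variables, distinct clauses, and at most three literals per clause. The Exponential Time Hypothesis (ETH) states that there is a real $\delta>0$ such that no deterministic multi-tape Turing machine decides $3SAT(\ell)$ in $O(2^{\delta\ell})$ time. \textbf{Theorem.} If ETH holds, then there is a real constant $k>0$ such that $$NDTIME(\lceil k\log_2 n\rceil,\,n)\nsubseteq DTIME(n).$$ -/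

import Mathlib

open Filter Asymptotics

/-- A multi-tape Turing machine with access to an oracle that supplies non-deterministic bits.
The tapes are two-way infinite (Mathlib's `Turing.Tape`), and the blank is `default`.
One step reads the symbols under all heads, writes a symbol on each tape, and moves each head
by at most one cell (`none` means that the head stays).  A state `q` with `query q = true`
consumes one oracle bit and its transition may depend on that bit. -/
structure MultiTapeTM where
  /-- The machine has `extraTapes + 1` tapes; tape `0` is the one that holds the input. -/
  extraTapes : ℕ
  Symbol : Type
  [symbolFintype : Fintype Symbol]
  [symbolInhabited : Inhabited Symbol]
  /-- The symbols for the two input bits. -/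
  bit : Bool → Symbol
  bit_injective : Function.Injective bit
  bit_ne_blank : ∀ a, bit a ≠ default
  State : Type
  [stateFintype : Fintype State]
  start : State
  /-- `some true`: accepting halting state, `some false`: rejecting halting state,
  `none`: not a halting state. -/
  verdict : State → Option Bool
  query : State → Bool
  trans : State → (Fin (extraTapes + 1) → Symbol) → Bool →
    State × (Fin (extraTapes + 1) → Symbol × Option Turing.Dir)

namespace MultiTapeTM

attribute [instance] symbolFintype symbolInhabited stateFintype

/-- A configuration; `used` counts the oracle bits consumed so far. -/
structure Cfg (M : MultiTapeTM) where
  state : M.State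
  tape : Fin (M.extraTapes + 1) → Turing.Tape M.Symbol
  used : ℕ

/-- Write a symbol and then move the head. -/
def act {Γ : Type} [Inhabited Γ] (a : Γ × Option Turing.Dir) (t : Turing.Tape Γ) :
    Turing.Tape Γ :=
  match a.2 with
  | none => t.write a.1
  | some d => (t.write a.1).move d

/-- One step, where `b` is the sequence of bits supplied by the oracle.  Halting configurations
are fixed.  In a non-query state the transition function is fed the constant `false`, so that it
does not depend on the oracle. -/
def step (M : MultiTapeTM) (b : ℕ → Bool) (c : M.Cfg) : M.Cfg :=
  match M.verdict c.state with
  | some _ => c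
  | none =>
    let r := M.trans c.state (fun i => (c.tape i).head) (M.query c.state && b c.used)
    { state := r.1
      tape := fun i => act (r.2 i) (c.tape i)
      used := c.used + (M.query c.state).toNat }

/-- The initial configuration: the input is written on tape `0` with the head on its first
symbol, and all other tapes are blank. -/
def init (M : MultiTapeTM) (x : List Bool) : M.Cfg where
  state := M.start
  tape := fun i => Turing.Tape.mk₁ (if i = 0 then x.map M.bit else [])
  used := 0

/-- The configuration after `t` steps on input `x` with oracle bits `b`. -/
def run (M : MultiTapeTM) (b : ℕ → Bool) (x : List Bool) (t : ℕ) : M.Cfg :=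
  (M.step b)^[t] (M.init x)

/-- The verdict reached within `t` steps (`none` if the machine has not halted by then). -/
def output (M : MultiTapeTM) (b : ℕ → Bool) (x : List Bool) (t : ℕ) : Option Bool :=
  M.verdict (M.run b x t).state

/-- A machine is deterministic if it never queries the oracle. -/
def IsDeterministic (M : MultiTapeTM) : Prop := ∀ q, M.query q = false

end MultiTapeTM

/-- `NDTIME f g`: the languages over `{0,1}` recognized in `O(g n)` time by a multi-tape Turing
machine with an `f n`-bit non-deterministic oracle.  On every input of length `n`, whatever the
oracle answers, the machine halts within `T n = O(g n)` steps and consumes at most `f n` oracle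
bits; the input belongs to the language iff some oracle answers lead to acceptance. -/
def NDTIME (f : ℕ → ℕ) (g : ℕ → ℝ) : Set (Language Bool) :=
  {L | ∃ (M : MultiTapeTM) (T : ℕ → ℕ),
    (fun n => (T n : ℝ)) =O[atTop] g ∧
    (∀ x b, M.output b x (T x.length) ≠ none ∧
      (M.run b x (T x.length)).used ≤ f x.length) ∧
    ∀ x, x ∈ L ↔ ∃ b, M.output b x (T x.length) = some true}

/-- Deterministic time `O(g n)` on multi-tape Turing machines. -/
def DTIME (g : ℕ → ℝ) : Set (Language Bool) := NDTIME (fun _ => 0) g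

/-- An instance of 3SAT: a list of distinct clauses over `numVars` variables, each with at most
three literals.  The literal `(v, true)` is the variable `v` and `(v, false)` its negation. -/
structure ThreeCNF where
  numVars : ℕ
  clauses : List (List (Fin numVars × Bool))
  width_le : ∀ c ∈ clauses, c.length ≤ 3
  distinct : clauses.Nodup

namespace ThreeCNF

/-- Some assignment makes at least one literal of every clause true. -/
def Satisfiable (φ : ThreeCNF) : Prop :=
  ∃ a : Fin φ.numVars → Bool, ∀ c ∈ φ.clauses, ∃ l ∈ c, a l.1 = l.2

/-- A literal is written as `1`, its sign, and the index of its variable in unary, closed by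
`0`. -/
def encodeLiteral {m : ℕ} (l : Fin m × Bool) : List Bool :=
  true :: l.2 :: (List.replicate (l.1 : ℕ) true ++ [false])

/-- A clause is the sequence of its literals, closed by `0`. -/
def encodeClause {m : ℕ} (c : List (Fin m × Bool)) : List Bool :=
  c.flatMap encodeLiteral ++ [false]

/-- An instance is written as its number of variables in unary, closed by `0`, followed by its
clauses.  As the clauses are distinct and have at most three literals, the length of the code is
bounded by a polynomial in the number of variables. -/
def encode (φ : ThreeCNF) : List Bool :=
  List.replicate φ.numVars true ++ false :: φ.clauses.flatMap encodeClause

/-- 3SAT on instances with `ℓ` variables is decided in deterministic time `O(g ℓ)`. -/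
def SolvableInTime (g : ℕ → ℝ) : Prop :=
  ∃ (M : MultiTapeTM) (T : ℕ → ℕ), M.IsDeterministic ∧
    (fun l => (T l : ℝ)) =O[atTop] g ∧
    ∀ φ : ThreeCNF, ∃ r : Bool,
      M.output (fun _ => false) φ.encode (T φ.numVars) = some r ∧ (r = true ↔ φ.Satisfiable)

end ThreeCNF

/-- The Exponential Time Hypothesis: for some `δ > 0`, 3SAT with `ℓ` variables cannot be decided
in deterministic time `O(2 ^ (δ ℓ))`. -/
def ExponentialTimeHypothesis : Prop :=
  ∃ δ : ℝ, 0 < δ ∧ ¬ ThreeCNF.SolvableInTime (fun l => (2 : ℝ) ^ (δ * (l : ℝ)))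

/-! The proof is a padding argument. Fix a positive integer `c ≥ 1/δ` and put `2 ^ m` zeros and a
one in front of the code of a formula with `ℓ` variables, where `m` is about `ℓ / c`. The padded
word has length `n ≥ 2 ^ m`, so `c log₂ n ≥ c m ≥ ℓ` bits suffice to guess an assignment, and linear
time suffices to check it. If this could be done deterministically in linear time, then writing the
padding and running the decider would solve 3SAT in time `O(2 ^ (ℓ / c) + poly ℓ)`, which is `O(2 ^
(δ ℓ))`, against ETH. Thus `k = c` works.

The substance is the construction of two machines. The verifier cannot afford to compute a logarithm
explicitly; it holds the padding length in a counter and buys `c` guesses with every successful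
halving. The halvings cost a geometric series, so the time is linear (`Mem.potential_step_lt`), and
`h` halvings require `2 ^ h ≤ n`, which bounds the guesses (`Mem.Paid.step`). Both bounds hold on
every input, well-formed or not. The language is therefore simply defined as what the verifier
accepts (`language_mem_NDTIME`), and only its restriction to padded formulas needs to be identified
with satisfiability (`padded_mem_language`). Since the running time is bounded separately, that
correctness proof need not count steps.

The solver works in the opposite direction: it doubles a counter once for every block of `c`
variables, writes that many zeros to the left of its input, and simulates the assumed decider
(`run_eq_cfg_start`, `output_encode`). Here the steps are counted, because they form the time bound.
Distinct clauses keep the code polynomially long (`ThreeCNF.length_encode_le`), and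
`solvableInTime_of_language_mem_DTIME` combines the estimates. -/

/-! ### Counters as head positions -/

section Counter

open Turing

/-- An operation on a counter; `dec` leaves the value `0` unchanged. -/
inductive CounterOp
  | keep
  | inc
  | dec

/-- The effect of a counter operation on the value. -/
def CounterOp.apply : CounterOp → ℕ → ℕ
  | keep, n => n
  | inc, n => n + 1
  | dec, n => n - 1

/-- The head movement that performs a counter operation, given whether the counter is zero. -/
def CounterOp.move : CounterOp → Bool → Option Dir
  | keep, _ => none
  | inc, _ => some Dir.right
  | dec, z => if z then none else some Dir.left

/-- The tape whose head is `n` cells to the right of that of `T`. -/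
def shiftRight {Γ : Type} [Inhabited Γ] (T : Tape Γ) (n : ℕ) : Tape Γ :=
  (Tape.move Dir.right)^[n] T

/-- The tape that represents the number `n`: the origin carries the mark `m`, the other cells are
blank, and the head is `n` cells to the right of the origin. -/
def counterTape {Γ : Type} [Inhabited Γ] (m : Γ) (n : ℕ) : Tape Γ :=
  shiftRight (Tape.mk₁ [m]) n

variable {Γ : Type} [Inhabited Γ]

theorem shiftRight_succ (T : Tape Γ) (n : ℕ) :
    shiftRight T (n + 1) = (shiftRight T n).move Dir.right :=
  Function.iterate_succ_apply' _ _ _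

theorem shiftRight_head (T : Tape Γ) (n : ℕ) : (shiftRight T n).head = T.nth (n : ℤ) :=
  Tape.move_right_n_head _ _

theorem counterTape_head (m : Γ) (n : ℕ) :
    (counterTape m n).head = if n = 0 then m else default := by
  rw [counterTape, shiftRight_head, Tape.mk₁, Tape.mk₂, Tape.mk'_nth_nat]
  cases n <;> simp [ListBlank.nth_mk, List.getI]

theorem counterTape_head_eq_iff {m : Γ} (hm : m ≠ default) (n : ℕ) :
    (counterTape m n).head = m ↔ n = 0 := by
  rw [counterTape_head]
  split_ifs with h
  · simp [h]
  · simp [h, hm.symm]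

theorem counterTape_succ (m : Γ) (n : ℕ) :
    counterTape m (n + 1) = (counterTape m n).move Dir.right :=
  shiftRight_succ _ _

theorem act_head_none (t : Tape Γ) : MultiTapeTM.act (t.head, none) t = t :=
  t.write_self

theorem act_head_some (d : Dir) (t : Tape Γ) :
    MultiTapeTM.act (t.head, some d) t = t.move d := by
  simp [MultiTapeTM.act, t.write_self]

theorem act_shiftRight (T : Tape Γ) (n : ℕ) :
    MultiTapeTM.act (T.nth (n : ℤ), none) (shiftRight T n) = shiftRight T n := by
  rw [← shiftRight_head, act_head_none]

/-- Only the origin carries the mark, so zero is recognized from the symbol under the head, and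
every counter operation is a single head movement. -/
theorem act_counterTape {m : Γ} (op : CounterOp) (n : ℕ) :
    MultiTapeTM.act ((counterTape m n).head, op.move (decide (n = 0))) (counterTape m n) =
      counterTape m (op.apply n) := by
  cases op
  · exact act_head_none _
  · simp only [CounterOp.move, CounterOp.apply, act_head_some, counterTape_succ]
  · cases n with
    | zero => exact act_head_none _
    | succ n =>
      simp [CounterOp.move, CounterOp.apply, act_head_some, counterTape_succ,
        Tape.move_right_left]

theorem act_mark_blank (m : Γ) :
    MultiTapeTM.act (m, none) (Tape.mk₁ []) = counterTape m 0 := by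
  simp [MultiTapeTM.act, counterTape, shiftRight, Tape.mk₁, Tape.mk₂, Tape.write_mk']

end Counter

/-! ### Runs and halting configurations -/

theorem MultiTapeTM.run_succ (M : MultiTapeTM) (b : ℕ → Bool) (x : List Bool) (t : ℕ) :
    M.run b x (t + 1) = M.step b (M.run b x t) :=
  Function.iterate_succ_apply' _ _ _

theorem MultiTapeTM.run_add (M : MultiTapeTM) (b : ℕ → Bool) (x : List Bool) (s t : ℕ) :
    M.run b x (s + t) = (M.step b)^[s] (M.run b x t) :=
  Function.iterate_add_apply _ _ _ _

theorem MultiTapeTM.step_of_verdict (M : MultiTapeTM) (b : ℕ → Bool) {c : M.Cfg}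
    (h : M.verdict c.state ≠ none) : M.step b c = c := by
  unfold MultiTapeTM.step
  cases h' : M.verdict c.state with
  | none => exact absurd h' h
  | some v => rfl

/-- Halting configurations are fixed points of `step`; this carries a verdict over to any later time
bound. -/
theorem MultiTapeTM.run_eq_of_verdict (M : MultiTapeTM) (b : ℕ → Bool) (x : List Bool) {s t : ℕ}
    (hst : s ≤ t) (h : M.verdict (M.run b x s).state ≠ none) : M.run b x t = M.run b x s := by
  obtain ⟨d, rfl⟩ := Nat.exists_eq_add_of_le' hst
  rw [M.run_add]
  exact Function.iterate_fixed (M.step_of_verdict b h) d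

/-! ### The verifier -/

/-- The control states of the verifier.  It guesses `c` bits for each halving of the padding. -/
inductive VerifierState (c : ℕ) : Type
  | boot
  | pad
  | var (j : Fin (c + 1))
  | guess (j : Fin (c + 1))
  | halveEven
  | halveOdd
  | checkHalf
  | moveBack
  | rewind (sat : Bool)
  | clause (sat : Bool)
  | sign (sat : Bool)
  | lit (sat s : Bool)
  | done (v : Bool)
  deriving Fintype

/-- An instruction of the verifier: the next state, whether to advance on the input, the operations
on the three counters, the bit to write (if any) and the movement on the assignment tape, and
whether to mark the origins of the counters. -/
structure VerifierInstr (c : ℕ) where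
  next : VerifierState c
  adv : Bool := false
  opA : CounterOp := .keep
  opB : CounterOp := .keep
  opE : CounterOp := .keep
  wr : Option Bool := none
  dir : Option Turing.Dir := none
  mark : Bool := false

namespace Verifier

open VerifierState

variable {c : ℕ}

/-- The program of the verifier.  The arguments after the state are the current input symbol,
whether each of the three counters is zero, the symbol on the assignment tape, and the oracle
bit. -/
def program : VerifierState c → Option Bool → Bool → Bool → Bool → Option Bool → Bool →
    VerifierInstr c
  | boot, _, _, _, _, _, _ => { next := pad, mark := true }
  | pad, some false, _, _, _, _, _ => { next := pad, adv := true, opA := .inc }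
  | pad, some true, _, _, _, _, _ => { next := var 0, adv := true }
  | pad, none, _, _, _, _, _ => { next := done false }
  | var j, some true, _, _, _, _, _ =>
    if j = 0 then { next := halveEven } else { next := guess (j - 1), adv := true }
  | var _, some false, _, _, _, _, _ => { next := rewind false, adv := true }
  | var _, none, _, _, _, _, _ => { next := done false }
  | guess j, _, _, _, _, _, o =>
    { next := var j, opE := .inc, wr := some o, dir := some Turing.Dir.right }
  | halveEven, _, true, _, _, _, _ => { next := checkHalf }
  | halveEven, _, false, _, _, _, _ => { next := halveOdd, opA := .dec }
  | halveOdd, _, true, _, _, _, _ => { next := checkHalf }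
  | halveOdd, _, false, _, _, _, _ => { next := halveEven, opA := .dec, opB := .inc }
  | checkHalf, _, _, true, _, _, _ => { next := done false }
  | checkHalf, _, _, false, _, _, _ => { next := moveBack, opA := .inc, opB := .dec }
  | moveBack, _, _, true, _, _, _ => { next := var (Fin.last c) }
  | moveBack, _, _, false, _, _, _ => { next := moveBack, opA := .inc, opB := .dec }
  | rewind s, _, _, _, true, _, _ => { next := clause s }
  | rewind s, _, _, _, false, _, _ =>
    { next := rewind s, opE := .dec, dir := some Turing.Dir.left }
  | clause _, none, _, _, _, _, _ => { next := done true }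
  | clause s, some false, _, _, _, _, _ =>
    if s then { next := clause false, adv := true } else { next := done false }
  | clause s, some true, _, _, _, _, _ => { next := sign s, adv := true }
  | sign _, none, _, _, _, _, _ => { next := done false }
  | sign s, some v, _, _, _, _, _ => { next := lit s v, adv := true }
  | lit _ _, none, _, _, _, _, _ => { next := done false }
  | lit s v, some true, _, _, _, _, _ =>
    { next := lit s v, adv := true, opE := .inc, dir := some Turing.Dir.right }
  | lit s v, some false, _, _, _, h, _ => { next := rewind (s || h == some v), adv := true }
  | done v, _, _, _, _, _, _ => { next := done v }

/-- The states in which the verifier guesses a bit. -/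
def isGuess : VerifierState c → Bool
  | guess _ => true
  | _ => false

/-- The verdicts of the verifier. -/
def verdict : VerifierState c → Option Bool
  | done v => some v
  | _ => none

/-- Whether a symbol is the mark at the origin of a counter. -/
def isMark (s : Option Bool) : Bool := decide (s = some true)

theorem isMark_counterTape (n : ℕ) :
    isMark (counterTape (some true) n).head = decide (n = 0) := by
  simp only [isMark, counterTape_head_eq_iff (Option.some_ne_none true)]

/-- The instruction that is executed when the symbols `s` are read. -/
def fetch (q : VerifierState c) (s : Fin 5 → Option Bool) (o : Bool) : VerifierInstr c :=
  program q (s 0) (isMark (s 1)) (isMark (s 2)) (isMark (s 3)) (s 4) o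

/-- The actions of an instruction on the tapes when the symbols `s` are read. -/
def actions (I : VerifierInstr c) (s : Fin 5 → Option Bool) :
    Fin 5 → Option Bool × Option Turing.Dir :=
  ![(s 0, if I.adv then some Turing.Dir.right else none),
    (if I.mark then some true else s 1, I.opA.move (isMark (s 1))),
    (if I.mark then some true else s 2, I.opB.move (isMark (s 2))),
    (if I.mark then some true else s 3, I.opE.move (isMark (s 3))),
    (I.wr.elim (s 4) some, I.dir)]

variable (c) in
/-- The verifier as a Turing machine.  Tape `0` holds the input, tapes `1`, `2`, `3` the counters,
and tape `4` the guessed assignment. -/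
def machine : MultiTapeTM where
  extraTapes := 4
  Symbol := Option Bool
  bit := some
  bit_injective := Option.some_injective _
  bit_ne_blank := fun _ => Option.some_ne_none _
  State := VerifierState c
  start := boot
  verdict := verdict
  query := isGuess
  trans q s o := ((fetch q s o).next, actions (fetch q s o) s)

variable (c) in
/-- The configurations of the verifier in terms of the remaining input, the values of the counters,
and the assignment tape. -/
structure Mem where
  state : VerifierState c
  rem : List Bool
  A : ℕ
  B : ℕ
  E : ℕ
  tape : Turing.Tape (Option Bool)
  used : ℕ

/-- The instruction that is executed in a given configuration. -/
def Mem.instr (b : ℕ → Bool) (m : Mem c) : VerifierInstr c :=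
  program m.state m.rem.head? (decide (m.A = 0)) (decide (m.B = 0)) (decide (m.E = 0)) m.tape.head
    (isGuess m.state && b m.used)

/-- One step of the verifier. -/
def Mem.step (b : ℕ → Bool) (m : Mem c) : Mem c where
  state := (m.instr b).next
  rem := if (m.instr b).adv then m.rem.tail else m.rem
  A := (m.instr b).opA.apply m.A
  B := (m.instr b).opB.apply m.B
  E := (m.instr b).opE.apply m.E
  tape := MultiTapeTM.act ((m.instr b).wr.elim m.tape.head some, (m.instr b).dir) m.tape
  used := m.used + (isGuess m.state).toNat

/-- A configuration of the Turing machine represents a configuration of the verifier. -/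
structure Represents (cfg : (machine c).Cfg) (m : Mem c) : Prop where
  state : cfg.state = m.state
  input : ∃ L, cfg.tape 0 = Turing.Tape.mk' L (Turing.ListBlank.mk (m.rem.map some))
  tape1 : cfg.tape 1 = counterTape (some true) m.A
  tape2 : cfg.tape 2 = counterTape (some true) m.B
  tape3 : cfg.tape 3 = counterTape (some true) m.E
  tape4 : cfg.tape 4 = m.tape
  used : cfg.used = m.used

theorem program_mark {q : VerifierState c} (hq : q ≠ boot) (i : Option Bool) (zA zB zE : Bool)
    (h : Option Bool) (o : Bool) : (program q i zA zB zE h o).mark = false := by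
  unfold program
  split <;> first | rfl | exact absurd rfl hq | (split_ifs <;> rfl)

theorem program_next_ne_boot (q : VerifierState c) (i : Option Bool) (zA zB zE : Bool)
    (h : Option Bool) (o : Bool) : (program q i zA zB zE h o).next ≠ boot := by
  unfold program
  split <;> first | (simp; done) | (split_ifs <;> simp)

theorem Mem.step_done (b : ℕ → Bool) {m : Mem c} {v : Bool} (h : m.state = done v) :
    m.step b = m := by
  obtain ⟨q, rem, A, B, E, tape, used⟩ := m
  subst h
  simp [Mem.step, Mem.instr, program, CounterOp.apply, act_head_none, isGuess]

/-- The state `boot` is excluded because its step writes the marks at the origins; every later step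
leaves the marks alone. -/
theorem Represents.step {cfg : (machine c).Cfg} {m : Mem c} (h : Represents cfg m)
    (hb : m.state ≠ boot) (b : ℕ → Bool) :
    Represents ((machine c).step b cfg) (m.step b) := by
  by_cases hv : verdict m.state = none
  · obtain ⟨L, hL⟩ := h.input
    have hv' : (machine c).verdict cfg.state = none := by rw [h.state]; exact hv
    set s : Fin 5 → Option Bool := fun i => (cfg.tape i).head
    have s0 : s 0 = m.rem.head? := 
      (congrArg Turing.Tape.head hL).trans (by cases m.rem <;> rfl)
    have s1 : isMark (s 1) = decide (m.A = 0) := 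
      (congrArg (fun t => isMark (Turing.Tape.head t)) h.tape1).trans (isMark_counterTape _)
    have s2 : isMark (s 2) = decide (m.B = 0) := 
      (congrArg (fun t => isMark (Turing.Tape.head t)) h.tape2).trans (isMark_counterTape _)
    have s3 : isMark (s 3) = decide (m.E = 0) := 
      (congrArg (fun t => isMark (Turing.Tape.head t)) h.tape3).trans (isMark_counterTape _)
    have s4 : s 4 = m.tape.head := congrArg Turing.Tape.head h.tape4
    have hI : fetch m.state s (isGuess m.state && b m.used) = m.instr b := by
      rw [fetch, s0, s1, s2, s3, s4, Mem.instr]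
    have hmark : (m.instr b).mark = false := program_mark hb _ _ _ _ _ _
    have key : (machine c).step b cfg =
        { state := (m.instr b).next
          tape := fun i => MultiTapeTM.act (actions (m.instr b) s i) (cfg.tape i)
          used := m.used + (isGuess m.state).toNat } := by
      rw [← hI, ← h.state, ← h.used]
      unfold MultiTapeTM.step
      rw [hv']
      rfl
    rw [key]
    refine ⟨rfl, ?_, ?_, ?_, ?_, ?_, rfl⟩
    · change ∃ L, MultiTapeTM.act ((cfg.tape 0).head, if (m.instr b).adv = true
        then _ else _) (cfg.tape 0) = _
      simp only [Mem.step]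
      split_ifs
      · rw [act_head_some, hL]
        refine ⟨_, (Turing.Tape.move_right_mk' L _).trans (congrArg _ ?_)⟩
        cases m.rem <;> rfl
      · rw [act_head_none]
        exact ⟨L, hL⟩
    · change MultiTapeTM.act (if (m.instr b).mark = true then some true else
        (cfg.tape 1).head, (m.instr b).opA.move (isMark (s 1))) (cfg.tape 1) = _
      rw [s1, hmark, h.tape1]
      exact act_counterTape _ _
    · change MultiTapeTM.act (if (m.instr b).mark = true then some true else
        (cfg.tape 2).head, (m.instr b).opB.move (isMark (s 2))) (cfg.tape 2) = _
      rw [s2, hmark, h.tape2]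
      exact act_counterTape _ _
    · change MultiTapeTM.act (if (m.instr b).mark = true then some true else
        (cfg.tape 3).head, (m.instr b).opE.move (isMark (s 3))) (cfg.tape 3) = _
      rw [s3, hmark, h.tape3]
      exact act_counterTape _ _
    · change MultiTapeTM.act ((m.instr b).wr.elim (s 4) some, (m.instr b).dir) (cfg.tape 4) = _
      rw [s4, h.tape4]
      rfl
  · have hd : ∃ v, m.state = done v := by
      revert hv
      cases m.state <;> simp [verdict]
    obtain ⟨v, hd⟩ := hd
    rw [Mem.step_done b hd, MultiTapeTM.step_of_verdict]
    · exact h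
    · rw [h.state]
      exact hv

variable (c) in
/-- The configuration after the counters have been set up. -/
def initMem (x : List Bool) : Mem c := ⟨pad, x, 0, 0, 0, Turing.Tape.mk₁ [], 0⟩

theorem represents_run_one (b : ℕ → Bool) (x : List Bool) :
    Represents ((machine c).run b x 1) (initMem c x) := by
  refine ⟨rfl, ⟨Turing.ListBlank.mk [], ?_⟩, act_mark_blank _, act_mark_blank _, act_mark_blank _,
    act_head_none _, rfl⟩
  exact act_head_none (Turing.Tape.mk₁ (x.map some))

theorem iterate_step_state_ne_boot (b : ℕ → Bool) (x : List Bool) (t : ℕ) :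
    ((Mem.step b)^[t] (initMem c x)).state ≠ boot := by
  cases t with
  | zero => simp [initMem]
  | succ t =>
    rw [Function.iterate_succ_apply']
    exact program_next_ne_boot _ _ _ _ _ _ _

theorem represents_run_succ (b : ℕ → Bool) (x : List Bool) (t : ℕ) :
    Represents ((machine c).run b x (t + 1)) ((Mem.step b)^[t] (initMem c x)) := by
  induction t with
  | zero => exact represents_run_one b x
  | succ t ih =>
    rw [MultiTapeTM.run_succ, Function.iterate_succ_apply']
    exact ih.step (iterate_step_state_ne_boot b x t) b

/-! ### Linear running time of the verifier -/

/-- The contribution of the state to the potential. -/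
def weight : VerifierState c → ℕ
  | boot => 2
  | pad => 1
  | var j => if j = 0 then 4 else 1
  | guess _ => 6
  | halveEven => 3
  | halveOdd => 5
  | checkHalf => 2
  | moveBack => 2
  | rewind _ => 2
  | clause _ => 1
  | sign _ => 1
  | lit _ _ => 1
  | done _ => 0

/-- A potential that decreases with every step of the verifier. -/
def Mem.potential (m : Mem c) : ℕ :=
  10 * m.rem.length + 3 * m.A + 4 * m.B + m.E + weight m.state

/-- A halving turns two units of `A`, worth 6, into one unit of `B`, worth 4, which returns to `A`
at worth 3; the state weights distribute the loss over single steps. Rewinding spends the `E` built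
up by guessing and by reading unary indices. With `c ≠ 0` a halving ends in a `var` state of weight
1, not in `var 0` of weight 4. -/
theorem Mem.potential_step_lt (hc : c ≠ 0) (b : ℕ → Bool) {m : Mem c}
    (h : verdict m.state = none) : (m.step b).potential < m.potential := by
  obtain ⟨q, rem, A, B, E, tape, used⟩ := m
  have hlast : Fin.last c ≠ 0 := by
    intro h
    exact hc (by simpa using congrArg Fin.val h)
  cases q with
  | var j =>
    rcases rem with _ | ⟨_ | _, rem⟩ <;> by_cases hj : j = 0 <;>
      simp [Mem.step, Mem.instr, program, Mem.potential, weight, CounterOp.apply, hj] <;> omega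
  | guess j =>
    by_cases hj : j = 0
    all_goals
      simp [Mem.step, Mem.instr, program, Mem.potential, weight, CounterOp.apply, hj]
      omega
  | halveEven | halveOdd =>
    cases A <;>
      simp [Mem.step, Mem.instr, program, Mem.potential, weight, CounterOp.apply] <;> omega
  | checkHalf | moveBack =>
    cases B <;>
      simp [Mem.step, Mem.instr, program, Mem.potential, weight, CounterOp.apply, hlast] <;> omega
  | rewind s =>
    cases E <;>
      simp [Mem.step, Mem.instr, program, Mem.potential, weight, CounterOp.apply]
  | clause s =>
    rcases rem with _ | ⟨_ | _, rem⟩ <;> cases s <;>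
      simp [Mem.step, Mem.instr, program, Mem.potential, weight, CounterOp.apply]
  | boot =>
    simp [Mem.step, Mem.instr, program, Mem.potential, weight, CounterOp.apply]
  | pad | sign | lit =>
    rcases rem with _ | ⟨_ | _, rem⟩ <;>
      simp [Mem.step, Mem.instr, program, Mem.potential, weight, CounterOp.apply] <;> omega
  | done v => exact absurd h (by simp [verdict])

theorem verdict_iterate_step (hc : c ≠ 0) (b : ℕ → Bool) (m : Mem c) {t : ℕ}
    (ht : m.potential ≤ t) : verdict ((Mem.step b)^[t] m).state ≠ none := by
  induction t generalizing m with
  | zero =>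
    intro h
    have : (m.step b).potential < m.potential := Mem.potential_step_lt hc b h
    omega
  | succ t ih =>
    rw [Function.iterate_succ_apply]
    by_cases h : verdict m.state = none
    · have := Mem.potential_step_lt hc b h
      exact ih _ (by omega)
    · have hs : m.step b = m := by
        cases hq : m.state with
        | done v => exact Mem.step_done b hq
        | _ => rw [hq] at h; exact absurd rfl h
      rw [hs, Function.iterate_fixed hs]
      exact h

/-- A time bound for the verifier on inputs of length `n`. -/
def time (n : ℕ) : ℕ := 10 * n + 2

theorem represents_run_time (b : ℕ → Bool) (x : List Bool) :
    Represents ((machine c).run b x (time x.length))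
      ((Mem.step b)^[10 * x.length + 1] (initMem c x)) :=
  represents_run_succ b x _

theorem output_time_ne_none (hc : c ≠ 0) (b : ℕ → Bool) (x : List Bool) :
    (machine c).output b x (time x.length) ≠ none := by
  rw [MultiTapeTM.output, (represents_run_time b x).state]
  exact verdict_iterate_step hc b _ (by simp [Mem.potential, initMem, weight])

/-! ### Number of oracle bits consumed by the verifier -/

/-- The number of bits that may still be guessed before the next halving. -/
def credit : VerifierState c → ℕ
  | var j => j
  | guess j => j + 1
  | moveBack => c
  | _ => 0

/-- The part of the padding that has not been used up by halvings. -/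
def Mem.level (m : Mem c) : ℕ :=
  match m.state with
  | boot => m.A + 2 * m.B + m.rem.length
  | pad => m.A + 2 * m.B + m.rem.length
  | var _ => m.A + 2 * m.B
  | guess _ => m.A + 2 * m.B
  | halveEven => m.A + 2 * m.B
  | halveOdd => m.A + 1 + 2 * m.B
  | checkHalf => 2 * m.A + 2 * m.B
  | moveBack => m.A + m.B
  | _ => 0

/-- The bits guessed so far are paid for by `h` halvings of a padding of length at most `n`. -/
def Mem.Paid (n : ℕ) (m : Mem c) : Prop :=
  ∃ h, m.used + credit m.state ≤ c * h ∧ (h = 0 ∨ 2 ^ h ≤ n) ∧ m.level * 2 ^ h ≤ n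

/-- New guesses are bought only in `checkHalf`; all other steps at most convert credit into consumed
bits or drop part of the padding. -/
theorem Mem.level_step_le (b : ℕ → Bool) {m : Mem c} (h : m.state ≠ checkHalf) :
    (m.step b).level ≤ m.level ∧
      (m.step b).used + credit (m.step b).state ≤ m.used + credit m.state := by
  obtain ⟨q, rem, A, B, E, tape, used⟩ := m
  cases q with
  | var j =>
    by_cases hj : j = 0
    · rcases rem with _ | ⟨_ | _, rem⟩ <;>
        simp [Mem.step, Mem.instr, program, Mem.level, credit, CounterOp.apply, hj, isGuess]
    · have := Fin.val_sub_one_of_ne_zero hj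
      have : (j : ℕ) ≠ 0 := fun h => hj (Fin.ext h)
      rcases rem with _ | ⟨_ | _, rem⟩ <;>
        simp [Mem.step, Mem.instr, program, Mem.level, credit, CounterOp.apply, hj, isGuess]
      omega
  | guess j =>
    simp [Mem.step, Mem.instr, program, Mem.level, credit, CounterOp.apply, isGuess]
    omega
  | halveEven =>
    cases A <;>
      simp [Mem.step, Mem.instr, program, Mem.level, credit, CounterOp.apply, isGuess]
  | halveOdd =>
    cases A <;>
      simp [Mem.step, Mem.instr, program, Mem.level, credit, CounterOp.apply, isGuess]
    omega
  | moveBack =>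
    cases B <;>
      simp [Mem.step, Mem.instr, program, Mem.level, credit, CounterOp.apply, isGuess]
    omega
  | checkHalf => exact absurd rfl h
  | rewind s =>
    cases E <;>
      simp [Mem.step, Mem.instr, program, Mem.level, credit, CounterOp.apply, isGuess]
  | clause s =>
    rcases rem with _ | ⟨_ | _, rem⟩ <;> cases s <;>
      simp [Mem.step, Mem.instr, program, Mem.level, credit, CounterOp.apply, isGuess]
  | boot =>
    simp [Mem.step, Mem.instr, program, Mem.level, credit, CounterOp.apply, isGuess]
  | pad =>
    rcases rem with _ | ⟨_ | _, rem⟩ <;>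
      simp [Mem.step, Mem.instr, program, Mem.level, credit, CounterOp.apply, isGuess]
    omega
  | sign | lit =>
    rcases rem with _ | ⟨_ | _, rem⟩ <;>
      simp [Mem.step, Mem.instr, program, Mem.level, credit, CounterOp.apply, isGuess]
  | done v =>
    rw [Mem.step_done b rfl]
    exact ⟨le_rfl, le_rfl⟩

/-- A halving succeeds only if something is left of the padding, and this forces `2 ^ (h + 1) ≤ n`.
The level in `checkHalf` counts `A` twice, so that the argument need not know that this counter is
empty there. -/
theorem Mem.Paid.step {n : ℕ} {m : Mem c} (hm : m.Paid n) (b : ℕ → Bool) :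
    (m.step b).Paid n := by
  obtain ⟨h, h1, h2, h3⟩ := hm
  by_cases hq : m.state = checkHalf
  · obtain ⟨q, rem, A, B, E, tape, used⟩ := m
    obtain rfl : q = checkHalf := hq
    cases B with
    | zero =>
      refine ⟨h, ?_, h2, ?_⟩
      · simpa [Mem.step, Mem.instr, program, credit, isGuess] using h1
      · simp [Mem.step, Mem.instr, program, Mem.level, CounterOp.apply]
    | succ B =>
      have h1' : used ≤ c * h := h1
      have h3' : (2 * A + 2 * (B + 1)) * 2 ^ h ≤ n := h3
      have h4 : (A + B + 1) * 2 ^ (h + 1) ≤ n := by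
        rw [pow_succ]
        calc _ = (2 * A + 2 * (B + 1)) * 2 ^ h := by ring
          _ ≤ n := h3'
      refine ⟨h + 1, ?_, Or.inr ?_, ?_⟩
      · simp [Mem.step, Mem.instr, program, credit, isGuess]
        linarith
      · exact (Nat.le_mul_of_pos_left _ (by omega)).trans h4
      · simp [Mem.step, Mem.instr, program, Mem.level, CounterOp.apply]
        linarith
  · obtain ⟨h5, h6⟩ := Mem.level_step_le b hq
    exact ⟨h, h6.trans h1, h2, (Nat.mul_le_mul_right _ h5).trans h3⟩

theorem paid_iterate_step (b : ℕ → Bool) (x : List Bool) (t : ℕ) :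
    ((Mem.step b)^[t] (initMem c x)).Paid x.length := by
  induction t with
  | zero => exact ⟨0, by simp [initMem, credit], Or.inl rfl, by simp [initMem, Mem.level]⟩
  | succ t ih =>
    rw [Function.iterate_succ_apply']
    exact ih.step b

theorem used_run_time_le (b : ℕ → Bool) (x : List Bool) :
    ((machine c).run b x (time x.length)).used ≤
      ⌈(c : ℝ) * Real.logb 2 (x.length : ℝ)⌉₊ := by
  rw [(represents_run_time b x).used]
  obtain ⟨h, h1, h2, -⟩ := paid_iterate_step (c := c) b x (10 * x.length + 1)
  have h3 : ((Mem.step b)^[10 * x.length + 1] (initMem c x)).used ≤ c * h := by omega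
  refine h3.trans ?_
  -- The case `h = 0` is separate because `2 ^ 0 ≤ n` fails for the empty input.
  rcases h2 with rfl | h2
  · simp
  · refine (Nat.cast_le (α := ℝ)).1 (le_trans ?_ (Nat.le_ceil _))
    push_cast
    refine mul_le_mul_of_nonneg_left ?_ (Nat.cast_nonneg c)
    have h4 : ((2 : ℝ) ^ h) ≤ x.length := by exact_mod_cast h2
    have h5 : (0 : ℝ) < x.length := lt_of_lt_of_le (by positivity) h4
    rw [Real.le_logb_iff_rpow_le one_lt_two h5, Real.rpow_natCast]
    exact h4

variable (c) in
/-- The language recognized by the verifier. -/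
def language : Language Bool :=
  {x | ∃ b, (machine c).output b x (time x.length) = some true}

theorem language_mem_NDTIME (hc : c ≠ 0) :
    language c ∈ NDTIME (fun n => ⌈(c : ℝ) * Real.logb 2 (n : ℝ)⌉₊) (fun n => (n : ℝ)) := by
  refine ⟨machine c, time, ?_, fun x b => ⟨output_time_ne_none hc b x, used_run_time_le b x⟩,
    fun x => Iff.rfl⟩
  refine IsBigO.of_bound 12 ((eventually_ge_atTop 1).mono fun n hn => ?_)
  have hn' : (1 : ℝ) ≤ n := by exact_mod_cast hn
  rw [Real.norm_of_nonneg (Nat.cast_nonneg _), Real.norm_of_nonneg (Nat.cast_nonneg _), time]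
  push_cast
  linarith

end Verifier

/-! ### Correctness of the verifier on padded formulas -/

theorem move_right_iterate_mk' {Γ : Type} [Inhabited Γ] (w L R : List Γ) :
    (Turing.Tape.move Turing.Dir.right)^[w.length]
        (Turing.Tape.mk' (Turing.ListBlank.mk L) (Turing.ListBlank.mk (w ++ R))) =
      Turing.Tape.mk' (Turing.ListBlank.mk (w.reverse ++ L)) (Turing.ListBlank.mk R) := by
  induction w generalizing L with
  | nil => rfl
  | cons a w ih =>
    rw [List.length_cons, Function.iterate_succ_apply, Turing.Tape.move_right_mk']
    simpa using ih (a :: L)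

namespace Verifier

open VerifierState

variable {c : ℕ} {b : ℕ → Bool}

/-- The configuration `m'` is reached from `m` after some number of steps. -/
def Reach (b : ℕ → Bool) (m m' : Mem c) : Prop := ∃ t, (Mem.step b)^[t] m = m'

theorem Reach.refl (m : Mem c) : Reach b m m := ⟨0, rfl⟩

theorem Reach.head {m m' m'' : Mem c} (h : m.step b = m') (h' : Reach b m' m'') :
    Reach b m m'' := by
  obtain ⟨t, ht⟩ := h'
  exact ⟨t + 1, by rw [Function.iterate_succ_apply, h, ht]⟩

theorem Reach.trans {m m' m'' : Mem c} (h : Reach b m m') (h' : Reach b m' m'') :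
    Reach b m m'' := by
  obtain ⟨t, rfl⟩ := h
  obtain ⟨s, rfl⟩ := h'
  exact ⟨s + t, Function.iterate_add_apply _ _ _ _⟩

theorem reach_pad (p : ℕ) (rem : List Bool) (A B E : ℕ) (T : Turing.Tape (Option Bool)) (u : ℕ) :
    Reach b (⟨pad, List.replicate p false ++ true :: rem, A, B, E, T, u⟩ : Mem c)
      ⟨var 0, rem, A + p, B, E, T, u⟩ := by
  induction p generalizing A with
  | zero =>
    refine Reach.head ?_ (Reach.refl _)
    simp [Mem.step, Mem.instr, program, CounterOp.apply, act_head_none, isGuess]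
  | succ p ih =>
    rw [show A + (p + 1) = A + 1 + p by omega]
    refine Reach.head ?_ (ih (A + 1))
    simp [Mem.step, Mem.instr, program, CounterOp.apply, act_head_none, isGuess,
      List.replicate_succ]

theorem reach_halve (a : ℕ) (rem : List Bool) (B E : ℕ) (T : Turing.Tape (Option Bool)) (u : ℕ) :
    Reach b (⟨halveEven, rem, 2 * a, B, E, T, u⟩ : Mem c) ⟨checkHalf, rem, 0, B + a, E, T, u⟩ := by
  induction a generalizing B with
  | zero =>
    refine Reach.head ?_ (Reach.refl _)
    simp [Mem.step, Mem.instr, program, CounterOp.apply, act_head_none, isGuess]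
  | succ a ih =>
    rw [show B + (a + 1) = B + 1 + a by omega]
    refine Reach.head (m' := ⟨halveOdd, rem, 2 * a + 1, B, E, T, u⟩) ?_ (Reach.head ?_
      (ih (B + 1)))
    · simp [Mem.step, Mem.instr, program, CounterOp.apply, act_head_none, isGuess]
      omega
    · simp [Mem.step, Mem.instr, program, CounterOp.apply, act_head_none, isGuess]

theorem reach_moveBack (rem : List Bool) (A B E : ℕ) (T : Turing.Tape (Option Bool)) (u : ℕ) :
    Reach b (⟨moveBack, rem, A, B, E, T, u⟩ : Mem c)
      ⟨var (Fin.last c), rem, A + B, 0, E, T, u⟩ := by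
  induction B generalizing A with
  | zero =>
    refine Reach.head ?_ (Reach.refl _)
    simp [Mem.step, Mem.instr, program, CounterOp.apply, act_head_none, isGuess]
  | succ B ih =>
    rw [show A + (B + 1) = A + 1 + B by omega]
    refine Reach.head ?_ (ih (A + 1))
    simp [Mem.step, Mem.instr, program, CounterOp.apply, act_head_none, isGuess]

theorem reach_var_last {a : ℕ} (ha : a ≠ 0) (rem : List Bool) (E : ℕ)
    (T : Turing.Tape (Option Bool)) (u : ℕ) :
    Reach b (⟨var 0, true :: rem, 2 * a, 0, E, T, u⟩ : Mem c)
      ⟨var (Fin.last c), true :: rem, a, 0, E, T, u⟩ := by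
  obtain ⟨a, rfl⟩ := Nat.exists_eq_succ_of_ne_zero ha
  refine Reach.head (m' := ⟨halveEven, true :: rem, 2 * (a + 1), 0, E, T, u⟩) ?_
    ((reach_halve _ _ _ _ _ _).trans (Reach.head
      (m' := ⟨moveBack, true :: rem, 1, a, E, T, u⟩) ?_
      (by simpa [Nat.add_comm] using reach_moveBack (b := b) (true :: rem) 1 a E T u)))
  · simp [Mem.step, Mem.instr, program, CounterOp.apply, act_head_none, isGuess]
  · simp [Mem.step, Mem.instr, program, CounterOp.apply, act_head_none, isGuess]

/-- The assignment tape after `i` guesses. -/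
def guessTape (b : ℕ → Bool) (i : ℕ) : Turing.Tape (Option Bool) :=
  Turing.Tape.mk' (Turing.ListBlank.mk (((List.range i).map (fun v => some (b v))).reverse))
    (Turing.ListBlank.mk [])

theorem act_guessTape (b : ℕ → Bool) (i : ℕ) :
    MultiTapeTM.act (some (b i), some Turing.Dir.right) (guessTape b i) = guessTape b (i + 1) := by
  simp [MultiTapeTM.act, guessTape, Turing.Tape.write_mk', Turing.Tape.move_right_mk',
    List.range_succ]

theorem guessTape_eq (b : ℕ → Bool) (n : ℕ) :
    guessTape b n = shiftRight (Turing.Tape.mk₁ ((List.range n).map (fun v => some (b v)))) n := by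
  have := move_right_iterate_mk' ((List.range n).map (fun v => some (b v))) [] []
  simp only [List.length_map, List.length_range, List.append_nil] at this
  rw [Turing.Tape.mk₁, Turing.Tape.mk₂, shiftRight, this, guessTape]

/-- With `j` guesses in stock and padding `2 ^ m`, another `j + c * m` variables can be served. The
counter `E`, the head position on the assignment tape and the number of consumed bits all equal `i`,
so cell `i` receives oracle bit `i`. -/
theorem reach_rewind_of_var (hc : c ≠ 0) (r : ℕ) (rem : List Bool) (j : Fin (c + 1)) (m i : ℕ)
    (h : r ≤ j + c * m) :
    ∃ A, Reach b (⟨var j, List.replicate r true ++ false :: rem, 2 ^ m, 0, i, guessTape b i, i⟩ :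
        Mem c) ⟨rewind false, rem, A, 0, i + r, guessTape b (i + r), i + r⟩ := by
  have guess_one : ∀ (j : Fin (c + 1)) (rem : List Bool) (A i : ℕ), j ≠ 0 →
      Reach b (⟨var j, true :: rem, A, 0, i, guessTape b i, i⟩ : Mem c)
        ⟨var (j - 1), rem, A, 0, i + 1, guessTape b (i + 1), i + 1⟩ := by
    intro j rem A i hj
    refine Reach.head (m' := ⟨guess (j - 1), rem, A, 0, i, guessTape b i, i⟩) ?_
      (Reach.head ?_ (Reach.refl _))
    · simp [Mem.step, Mem.instr, program, CounterOp.apply, act_head_none, isGuess, hj]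
    · simp [Mem.step, Mem.instr, program, CounterOp.apply, act_guessTape, isGuess]
  induction r generalizing j m i with
  | zero =>
    refine ⟨2 ^ m, Reach.head ?_ (Reach.refl _)⟩
    simp [Mem.step, Mem.instr, program, CounterOp.apply, act_head_none, isGuess]
  | succ r ih =>
    rw [List.replicate_succ, List.cons_append, Nat.add_comm r 1, ← Nat.add_assoc]
    by_cases hj : j = 0
    · subst hj
      -- The stock is empty but a variable remains, so the hypothesis leaves at least one halving.
      have hm : m ≠ 0 := by
        rintro rfl
        simp at h
      obtain ⟨m, rfl⟩ := Nat.exists_eq_succ_of_ne_zero hm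
      have hlast : Fin.last c ≠ 0 := by
        intro h
        exact hc (by simpa using congrArg Fin.val h)
      have hv := Fin.val_sub_one_of_ne_zero hlast
      obtain ⟨A, hA⟩ := ih (Fin.last c - 1) m (i + 1) (by
        rw [hv, Fin.val_last]
        rw [Nat.succ_eq_add_one, Nat.mul_add, Fin.val_zero] at h
        omega)
      refine ⟨A, Reach.trans ?_ ((guess_one _ _ (2 ^ m) i hlast).trans hA)⟩
      rw [Nat.succ_eq_add_one, pow_succ']
      exact reach_var_last (by positivity) _ _ _ _
    · have hv := Fin.val_sub_one_of_ne_zero hj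
      obtain ⟨A, hA⟩ := ih (j - 1) m (i + 1) (by omega)
      exact ⟨A, (guess_one _ _ _ i hj).trans hA⟩

/-- The counter `E` records the distance of the head from cell `0` of the assignment tape, which
need not carry a mark of its own. -/
theorem reach_clause_of_rewind (s : Bool) (rem : List Bool) (A B E : ℕ)
    (T : Turing.Tape (Option Bool)) (u : ℕ) :
    Reach b (⟨rewind s, rem, A, B, E, shiftRight T E, u⟩ : Mem c) ⟨clause s, rem, A, B, 0, T, u⟩ := by
  induction E with
  | zero =>
    refine Reach.head ?_ (Reach.refl _)
    simp [Mem.step, Mem.instr, program, CounterOp.apply, act_head_none, isGuess, shiftRight]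
  | succ E ih =>
    refine Reach.head ?_ ih
    simp [Mem.step, Mem.instr, program, CounterOp.apply, act_head_some, isGuess, shiftRight_succ,
      Turing.Tape.move_right_left]

theorem reach_rewind_of_lit (s v : Bool) (k : ℕ) (rem : List Bool) (A B E : ℕ)
    (T : Turing.Tape (Option Bool)) (u : ℕ) :
    Reach b (⟨lit s v, List.replicate k true ++ false :: rem, A, B, E, shiftRight T E, u⟩ : Mem c)
      ⟨rewind (s || T.nth ((E + k : ℕ) : ℤ) == some v), rem, A, B, E + k, shiftRight T (E + k), u⟩ := by
  induction k generalizing E with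
  | zero =>
    refine Reach.head ?_ (Reach.refl _)
    simp [Mem.step, Mem.instr, program, CounterOp.apply, isGuess, act_shiftRight, shiftRight_head]
  | succ k ih =>
    rw [show E + (k + 1) = E + 1 + k by omega]
    refine Reach.head ?_ (ih (E + 1))
    simp [Mem.step, Mem.instr, program, CounterOp.apply, act_head_some, isGuess, shiftRight_succ,
      List.replicate_succ]

variable {n : ℕ} {T : Turing.Tape (Option Bool)} {a : Fin n → Bool}

theorem reach_literal (hT : ∀ v : Fin n, T.nth ((v : ℕ) : ℤ) = some (a v)) (s : Bool)
    (l : Fin n × Bool) (rem : List Bool) (A B u : ℕ) :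
    Reach b (⟨clause s, ThreeCNF.encodeLiteral l ++ rem, A, B, 0, T, u⟩ : Mem c)
      ⟨clause (s || a l.1 == l.2), rem, A, B, 0, T, u⟩ := by
  have h := (reach_rewind_of_lit (c := c) (b := b) s l.2 l.1 rem A B 0 T u).trans
    (reach_clause_of_rewind _ _ _ _ _ _ _)
  simp only [Nat.zero_add, hT] at h
  refine Reach.head (m' := ⟨sign s, l.2 :: (List.replicate (l.1 : ℕ) true ++ false :: rem), A, B,
    0, T, u⟩) ?_ (Reach.head ?_ h)
  · simp [Mem.step, Mem.instr, program, CounterOp.apply, act_head_none, isGuess,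
      ThreeCNF.encodeLiteral]
  · simp [Mem.step, Mem.instr, program, CounterOp.apply, act_head_none, isGuess, shiftRight]

theorem reach_literals (hT : ∀ v : Fin n, T.nth ((v : ℕ) : ℤ) = some (a v)) (s : Bool)
    (ls : List (Fin n × Bool)) (rem : List Bool) (A B u : ℕ) :
    Reach b (⟨clause s, ls.flatMap ThreeCNF.encodeLiteral ++ rem, A, B, 0, T, u⟩ : Mem c)
      ⟨clause (s || ls.any fun l => a l.1 == l.2), rem, A, B, 0, T, u⟩ := by
  induction ls generalizing s with
  | nil => simpa using Reach.refl _
  | cons l ls ih =>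
    rw [List.flatMap_cons, List.append_assoc]
    refine (reach_literal hT s l _ A B u).trans ?_
    rw [List.any_cons, ← Bool.or_assoc]
    exact ih _

/-- The flag of `clause` accumulates the disjunction over the literals read so far; the end of a
clause resets it if it is true and rejects otherwise. -/
theorem reach_clauses (hT : ∀ v : Fin n, T.nth ((v : ℕ) : ℤ) = some (a v))
    (cs : List (List (Fin n × Bool))) (A B u : ℕ) :
    ∃ m : Mem c, m.state = done (cs.all fun ls => ls.any fun l => a l.1 == l.2) ∧
      Reach b (⟨clause false, cs.flatMap ThreeCNF.encodeClause, A, B, 0, T, u⟩ : Mem c) m := by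
  induction cs with
  | nil =>
    refine ⟨_, ?_, Reach.head rfl (Reach.refl _)⟩
    simp [Mem.step, Mem.instr, program]
  | cons ls cs ih =>
    obtain ⟨m, hm, hr⟩ := ih
    have h := reach_literals (c := c) (b := b) hT false ls
      (false :: cs.flatMap ThreeCNF.encodeClause) A B u
    rw [List.flatMap_cons, ThreeCNF.encodeClause, List.append_assoc, List.all_cons,
      List.singleton_append]
    rw [Bool.false_or] at h
    cases hv : ls.any fun l => a l.1 == l.2 with
    | false =>
      rw [hv] at h
      refine ⟨_, ?_, h.trans (Reach.head rfl (Reach.refl _))⟩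
      simp [Mem.step, Mem.instr, program]
    | true =>
      rw [hv] at h
      refine ⟨m, by simpa using hm, h.trans (Reach.head ?_ hr)⟩
      simp [Mem.step, Mem.instr, program, CounterOp.apply, act_head_none, isGuess]

/-- A formula preceded by `p` padding symbols. -/
def padded (p : ℕ) (φ : ThreeCNF) : List Bool := List.replicate p false ++ true :: φ.encode

theorem output_padded (hc : c ≠ 0) {m : ℕ} (φ : ThreeCNF) (h : φ.numVars ≤ c * m)
    (b : ℕ → Bool) :
    (machine c).output b (padded (2 ^ m) φ) (time (padded (2 ^ m) φ).length) =
      some (φ.clauses.all fun ls => ls.any fun l => b l.1 == l.2) := by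
  set x := padded (2 ^ m) φ with hx
  obtain ⟨A, hA⟩ := reach_rewind_of_var (b := b) hc φ.numVars
    (φ.clauses.flatMap ThreeCNF.encodeClause) 0 m 0 (by simpa using h)
  have hT : ∀ v : Fin φ.numVars,
      (Turing.Tape.mk₁ ((List.range φ.numVars).map (fun v => some (b v)))).nth ((v : ℕ) : ℤ) =
        some (b v) := by
    intro v
    rw [Turing.Tape.mk₁, Turing.Tape.mk₂, Turing.Tape.mk'_nth_nat, Turing.ListBlank.nth_mk]
    simp [List.getI_eq_getElem]
  obtain ⟨mem, hmem, hr⟩ := reach_clauses (c := c) (b := b) (a := fun v => b v) hT φ.clauses A 0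
    φ.numVars
  have h1 := reach_pad (c := c) (b := b) (2 ^ m) φ.encode 0 0 0 (Turing.Tape.mk₁ []) 0
  rw [Nat.zero_add] at h1 hA
  rw [guessTape_eq b φ.numVars] at hA
  obtain ⟨t, ht⟩ := ((h1.trans hA).trans (reach_clause_of_rewind _ _ _ _ _ _ _)).trans hr
  have ht' : ((machine c).run b x (t + 1)).state = mem.state := by
    rw [(represents_run_succ b x t).state]
    exact congrArg Mem.state ht
  have hv : (machine c).output b x (t + 1) =
      some (φ.clauses.all fun ls => ls.any fun l => b l.1 == l.2) := by
    rw [MultiTapeTM.output, ht', hmem]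
    rfl
  rw [← hv]
  have hv' : (machine c).output b x (t + 1) ≠ none := by simp [hv]
  -- Nothing is known about `t`, but the machine has halted both at `t + 1` and at the time bound,
  -- so the two verdicts agree.
  rcases le_total (t + 1) (time x.length) with hle | hle
  · rw [MultiTapeTM.output, MultiTapeTM.run_eq_of_verdict _ _ _ hle hv', MultiTapeTM.output]
  · rw [MultiTapeTM.output, MultiTapeTM.output,
      MultiTapeTM.run_eq_of_verdict _ _ _ hle (output_time_ne_none hc b x)]

theorem padded_mem_language (hc : c ≠ 0) {m : ℕ} (φ : ThreeCNF) (h : φ.numVars ≤ c * m) :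
    padded (2 ^ m) φ ∈ language c ↔ φ.Satisfiable := by
  have key : padded (2 ^ m) φ ∈ language c ↔
      ∃ b : ℕ → Bool, ∀ ls ∈ φ.clauses, ∃ l ∈ ls, b l.1 = l.2 := by
    refine exists_congr fun b => ?_
    rw [output_padded hc φ h b]
    simp
  rw [key]
  constructor
  · rintro ⟨b, hb⟩
    exact ⟨fun v => b v, hb⟩
  · rintro ⟨a, ha⟩
    -- The bits beyond the last variable do not occur in any clause; `false` is a filler.
    refine ⟨fun v => if hv : v < φ.numVars then a ⟨v, hv⟩ else false, fun ls hls => ?_⟩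
    obtain ⟨l, hl, hal⟩ := ha ls hls
    exact ⟨l, hl, by simpa using hal⟩

end Verifier

/-! ### The solver -/

/-- The control states of the padding phase of the solver.  It doubles the padding once for every
`c` variables. -/
inductive PadderState (c : ℕ) : Type
  | boot
  | scan (j : Fin (c + 1))
  | double
  | doubleAgain
  | copy
  | back
  | fill
  deriving Fintype

/-- An instruction of the padding phase: the next state (`none` is the end of the phase), the bit
to write (if any) and the movement on the input tape, the operations on the two counters, and
whether to mark the origins of the counters. -/
structure PadderInstr (c : ℕ) where
  next : Option (PadderState c)
  wr : Option Bool := none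
  dir : Option Turing.Dir := none
  opA : CounterOp := .keep
  opB : CounterOp := .keep
  mark : Bool := false

namespace Solver

open PadderState

variable {c : ℕ}

/-- The program of the padding phase.  The arguments after the state are whether the current
symbol is the bit `1`, whether it is blank, and whether each of the two counters is zero. -/
def program : PadderState c → Bool → Bool → Bool → Bool → PadderInstr c
  | boot, _, _, _, _ => { next := some (scan 0), opA := .inc, mark := true }
  | scan j, true, _, _, _ =>
    if j = 0 then { next := some double }
    else { next := some (scan (j - 1)), dir := some Turing.Dir.right }
  | scan _, false, _, _, _ => { next := some back, dir := some Turing.Dir.left }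
  | double, _, _, true, _ => { next := some copy }
  | double, _, _, false, _ => { next := some doubleAgain, opA := .dec, opB := .inc }
  | doubleAgain, _, _, _, _ => { next := some double, opB := .inc }
  | copy, _, _, _, true => { next := some (scan (Fin.last c)) }
  | copy, _, _, _, false => { next := some copy, opA := .inc, opB := .dec }
  | back, _, true, _, _ => { next := some fill, wr := some true, dir := some Turing.Dir.left }
  | back, _, false, _, _ => { next := some back, dir := some Turing.Dir.left }
  | fill, _, _, true, _ => { next := none, dir := some Turing.Dir.right }
  | fill, _, _, false, _ =>
    { next := some fill, wr := some false, dir := some Turing.Dir.left, opA := .dec }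

open Classical in
/-- The instruction that is executed in the state `p` when `s` is read on the input tape and
`a`, `b` on the tapes of the counters. -/
noncomputable def fetch (D : MultiTapeTM) (p : PadderState c) (s a b : D.Symbol) : PadderInstr c :=
  program p (decide (s = D.bit true)) (decide (s = default)) (decide (a = D.bit true))
    (decide (b = D.bit true))

/-- The action of an instruction of the padding phase on the input tape. -/
def inputAction (D : MultiTapeTM) (I : PadderInstr c) (s : D.Symbol) :
    D.Symbol × Option Turing.Dir :=
  (I.wr.elim s D.bit, I.dir)

open Classical in
/-- The action of a counter operation on the tape of the counter. -/
noncomputable def counterAction (D : MultiTapeTM) (mark : Bool) (op : CounterOp) (s : D.Symbol) :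
    D.Symbol × Option Turing.Dir :=
  (if mark then D.bit true else s, op.move (decide (s = D.bit true)))

/-- The actions of an instruction of the padding phase on the tapes when `s` is read. -/
noncomputable def actions (D : MultiTapeTM) (I : PadderInstr c)
    (s : Fin (D.extraTapes + 3) → D.Symbol) (i : Fin (D.extraTapes + 3)) :
    D.Symbol × Option Turing.Dir :=
  if (i : ℕ) = 0 then inputAction D I (s i)
  else if (i : ℕ) = D.extraTapes + 1 then counterAction D I.mark I.opA (s i)
  else if (i : ℕ) = D.extraTapes + 2 then counterAction D I.mark I.opB (s i)
  else (s i, none)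

/-- The tapes of the solver on which `D` runs. -/
def innerTape (D : MultiTapeTM) (i : Fin (D.extraTapes + 1)) : Fin (D.extraTapes + 3) :=
  i.castLE (by omega)

/-- The machine that pads its input and then runs the machine `D`.  Its last two tapes hold the
counters of the padding phase. -/
noncomputable def machine (c : ℕ) (D : MultiTapeTM) : MultiTapeTM where
  extraTapes := D.extraTapes + 2
  Symbol := D.Symbol
  bit := D.bit
  bit_injective := D.bit_injective
  bit_ne_blank := D.bit_ne_blank
  State := PadderState c ⊕ D.State
  start := Sum.inl boot
  verdict := Sum.elim (fun _ => none) D.verdict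
  query := fun _ => false
  trans q s _ :=
    match q with
    | Sum.inl p =>
      let I := fetch D p (s 0) (s ⟨D.extraTapes + 1, by omega⟩) (s ⟨D.extraTapes + 2, by omega⟩)
      (I.next.elim (Sum.inr D.start) Sum.inl, actions D I s)
    | Sum.inr q =>
      let r := D.trans q (fun i => s (innerTape D i)) false
      (Sum.inr r.1, fun i =>
        if h : (i : ℕ) < D.extraTapes + 1 then r.2 ⟨i, h⟩ else (s i, none))

variable {D : MultiTapeTM}

/-- The tapes of the solver with the given input tape and counters, and otherwise blank. -/
def tapes (t : Turing.Tape D.Symbol) (a b : ℕ) (i : Fin (D.extraTapes + 3)) :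
    Turing.Tape D.Symbol :=
  if (i : ℕ) = 0 then t
  else if (i : ℕ) = D.extraTapes + 1 then counterTape (D.bit true) a
  else if (i : ℕ) = D.extraTapes + 2 then counterTape (D.bit true) b
  else Turing.Tape.mk₁ []

/-- The configuration of the solver with the given state and tapes. -/
noncomputable def mkCfg (q : PadderState c ⊕ D.State)
    (T : Fin (D.extraTapes + 3) → Turing.Tape D.Symbol) : (machine c D).Cfg where
  state := q
  tape := T
  used := 0

/-- The configuration of the solver with the given state, input tape and counters, in which the
other tapes are blank. -/
noncomputable def cfg (q : PadderState c ⊕ D.State) (t : Turing.Tape D.Symbol) (a b : ℕ) :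
    (machine c D).Cfg :=
  mkCfg q (tapes t a b)

theorem step_mkCfg (p : PadderState c) (T : Fin (D.extraTapes + 3) → Turing.Tape D.Symbol)
    (o : ℕ → Bool) {I : PadderInstr c}
    (hI : fetch D p (T 0).head (T ⟨D.extraTapes + 1, by omega⟩).head
      (T ⟨D.extraTapes + 2, by omega⟩).head = I) :
    (machine c D).step o (mkCfg (Sum.inl p) T) =
      mkCfg (I.next.elim (Sum.inr D.start) Sum.inl)
        (fun i => MultiTapeTM.act (actions D I (fun i => (T i).head) i) (T i)) := by
  rw [← hI]
  rfl

theorem program_mark {p : PadderState c} (hp : p ≠ boot) (x y z w : Bool) :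
    (program p x y z w).mark = false := by
  unfold program
  split <;> first | rfl | exact absurd rfl hp | (split_ifs <;> rfl)

theorem decide_counterTape_head (n : ℕ) [Decidable ((counterTape (D.bit true) n).head = D.bit true)] :
    decide ((counterTape (D.bit true) n).head = D.bit true) = decide (n = 0) := by
  simp only [counterTape_head_eq_iff (D.bit_ne_blank true)]

theorem act_counterAction (op : CounterOp) (n : ℕ) :
    MultiTapeTM.act (counterAction D false op (counterTape (D.bit true) n).head)
      (counterTape (D.bit true) n) = counterTape (D.bit true) (op.apply n) := by
  classical
  rw [counterAction, decide_counterTape_head]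
  exact act_counterTape _ _

theorem act_actions {I : PadderInstr c} (hI : I.mark = false) (t : Turing.Tape D.Symbol)
    (a b : ℕ) :
    (fun i => MultiTapeTM.act (actions D I (fun i => (tapes t a b i).head) i) (tapes t a b i)) =
      tapes (MultiTapeTM.act (I.wr.elim t.head D.bit, I.dir) t) (I.opA.apply a)
        (I.opB.apply b) := by
  funext i
  simp only [actions, tapes, hI]
  split_ifs
  · rfl
  · exact act_counterAction _ _
  · exact act_counterAction _ _
  · exact act_head_none _

open Classical in
theorem step_cfg {p : PadderState c} (hp : p ≠ boot) (t : Turing.Tape D.Symbol) (a b : ℕ)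
    (o : ℕ → Bool) {I : PadderInstr c}
    (hI : program p (decide (t.head = D.bit true)) (decide (t.head = default)) (decide (a = 0))
      (decide (b = 0)) = I) :
    (machine c D).step o (cfg (Sum.inl p) t a b) =
      cfg (I.next.elim (Sum.inr D.start) Sum.inl)
        (MultiTapeTM.act (I.wr.elim t.head D.bit, I.dir) t) (I.opA.apply a) (I.opB.apply b) := by
  have hm : I.mark = false := hI ▸ program_mark hp _ _ _ _
  have hf : fetch D p (tapes t a b 0).head (tapes t a b ⟨D.extraTapes + 1, by omega⟩).head
      (tapes t a b ⟨D.extraTapes + 2, by omega⟩).head = I := by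
    have h0 : tapes t a b 0 = t := rfl
    have h1 : tapes t a b ⟨D.extraTapes + 1, by omega⟩ = counterTape (D.bit true) a := by
      simp [tapes]
    have h2 : tapes t a b ⟨D.extraTapes + 2, by omega⟩ = counterTape (D.bit true) b := by
      simp [tapes]
    rw [h0, h1, h2, fetch, decide_counterTape_head, decide_counterTape_head, hI]
  rw [cfg, step_mkCfg p _ o hf, act_actions hm, cfg]

/-- The first counter starts at `1`, so that `m` doublings produce `2 ^ m`. -/
theorem run_one (o : ℕ → Bool) (x : List Bool) :
    (machine c D).run o x 1 = cfg (Sum.inl (scan 0)) (Turing.Tape.mk₁ (x.map D.bit)) 1 0 := by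
  have hA : MultiTapeTM.act (counterAction D true .inc (Turing.Tape.mk₁ []).head)
      (Turing.Tape.mk₁ []) = counterTape (D.bit true) 1 := by
    rw [counterTape_succ, ← act_mark_blank]
    rfl
  have hB : MultiTapeTM.act (counterAction D true .keep (Turing.Tape.mk₁ []).head)
      (Turing.Tape.mk₁ []) = counterTape (D.bit true) 0 := by
    rw [← act_mark_blank]
    rfl
  let T : Fin (D.extraTapes + 3) → Turing.Tape D.Symbol := fun i =>
    Turing.Tape.mk₁ (if i = 0 then x.map D.bit else [])
  let I : PadderInstr c := { next := some (scan 0), opA := .inc, mark := true }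
  have key : (fun i => MultiTapeTM.act (actions D I (fun i => (T i).head) i) (T i)) =
      tapes (Turing.Tape.mk₁ (x.map D.bit)) 1 0 := by
    funext i
    have hi : (i = 0) = ((i : ℕ) = 0) := propext (Fin.ext_iff)
    simp only [actions, tapes, T, I, hi]
    split_ifs
    · exact act_head_none _
    · exact hA
    · exact hB
    · exact act_head_none _
  rw [cfg, ← key]
  rfl

/-! #### The padding phase -/

/-- The configuration `m'` is reached from `m` after exactly `s` steps. -/
def Reach (o : ℕ → Bool) (s : ℕ) (m m' : (machine c D).Cfg) : Prop :=
  ((machine c D).step o)^[s] m = m'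

variable {o : ℕ → Bool}

theorem Reach.trans {s s' : ℕ} {m m' m'' : (machine c D).Cfg} (h : Reach o s m m')
    (h' : Reach o s' m' m'') : Reach o (s' + s) m m'' := by
  rw [Reach, Function.iterate_add_apply, h]
  exact h'

theorem Reach.head {s : ℕ} {m m' m'' : (machine c D).Cfg}
    (h : (machine c D).step o m = m') (h' : Reach o s m' m'') : Reach o (s + 1) m m'' := by
  rw [Reach, Function.iterate_succ_apply, h]
  exact h'

theorem Reach.one {m m' : (machine c D).Cfg} (h : (machine c D).step o m = m') :
    Reach o 1 m m' := h

theorem reach_double (t : Turing.Tape D.Symbol) (a b : ℕ) :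
    Reach o (2 * a + 1) (cfg (c := c) (Sum.inl double) t a b)
      (cfg (Sum.inl copy) t 0 (b + 2 * a)) := by
  induction a generalizing b with
  | zero =>
    refine Reach.one ((step_cfg (by simp) _ _ _ _ rfl).trans ?_)
    simp [program, CounterOp.apply, act_head_none]
  | succ a ih =>
    rw [show 2 * (a + 1) + 1 = 2 * a + 1 + 1 + 1 by omega,
      show b + 2 * (a + 1) = b + 1 + 1 + 2 * a by omega]
    refine Reach.head (m' := cfg (Sum.inl doubleAgain) t a (b + 1))
      ((step_cfg (by simp) _ _ _ _ rfl).trans ?_)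
      (Reach.head ((step_cfg (by simp) _ _ _ _ rfl).trans ?_) (ih _))
    · simp [program, CounterOp.apply, act_head_none]
    · simp [program, CounterOp.apply, act_head_none]

theorem reach_copy (t : Turing.Tape D.Symbol) (a b : ℕ) :
    Reach o (b + 1) (cfg (c := c) (Sum.inl copy) t a b)
      (cfg (Sum.inl (scan (Fin.last c))) t (a + b) 0) := by
  induction b generalizing a with
  | zero =>
    refine Reach.one ((step_cfg (by simp) _ _ _ _ rfl).trans ?_)
    simp [program, CounterOp.apply, act_head_none]
  | succ b ih =>
    rw [show a + (b + 1) = a + 1 + b by omega]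
    refine Reach.head ((step_cfg (by simp) _ _ _ _ rfl).trans ?_) (ih _)
    simp [program, CounterOp.apply, act_head_none]

theorem reach_scan_last {t : Turing.Tape D.Symbol} (ht : t.head = D.bit true) (a : ℕ) :
    Reach o (4 * a + 3) (cfg (c := c) (Sum.inl (scan 0)) t a 0)
      (cfg (Sum.inl (scan (Fin.last c))) t (2 * a) 0) := by
  have h := (reach_double (o := o) (c := c) t a 0).trans (reach_copy t 0 (0 + 2 * a))
  rw [show 4 * a + 3 = 0 + 2 * a + 1 + (2 * a + 1) + 1 by omega]
  simp only [Nat.zero_add] at h ⊢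
  refine Reach.head ((step_cfg (by simp) _ _ _ _ rfl).trans ?_) h
  have := act_head_none t
  rw [ht] at this
  simp [program, CounterOp.apply, this, ht]

theorem reach_scan_one {T : Turing.Tape D.Symbol} {i : ℕ} (hT : T.nth (i : ℤ) = D.bit true)
    {j : Fin (c + 1)} (hj : j ≠ 0) (a : ℕ) :
    Reach o 1 (cfg (Sum.inl (scan j)) (shiftRight T i) a 0)
      (cfg (Sum.inl (scan (j - 1))) (shiftRight T (i + 1)) a 0) := by
  have ht : (shiftRight T i).head = D.bit true := by rw [shiftRight_head, hT]
  refine Reach.one ((step_cfg (by simp) _ _ _ _ rfl).trans ?_)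
  have := act_head_some Turing.Dir.right (shiftRight T i)
  rw [ht] at this
  simp [program, CounterOp.apply, this, ht, hj, shiftRight_succ]

/-- Doubling `a` costs `4 * a + 3` steps, which together with the move to the next symbol is paid
for by the growth of `8 * a`, as `a ≥ 1`. The term `8 * a` on the left makes this geometric sum
telescope in the induction. The two bounds on `c * m` allow for the `j` variables still to be read
before the next doubling. -/
theorem reach_back_of_scan (hc : c ≠ 0) {T : Turing.Tape D.Symbol} (r : ℕ) :
    ∀ (i a : ℕ) (j : Fin (c + 1)), (∀ v < i + r, T.nth (v : ℤ) = D.bit true) →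
      T.nth ((i + r : ℕ) : ℤ) = D.bit false → 1 ≤ a →
      ∃ m s, r ≤ j + c * m ∧ c * m + j ≤ r + c ∧ s + 8 * a ≤ 8 * (a * 2 ^ m) + r + 1 ∧
        Reach o s (cfg (Sum.inl (scan j)) (shiftRight T i) a 0)
          (cfg (Sum.inl back) ((shiftRight T (i + r)).move Turing.Dir.left) (a * 2 ^ m) 0) := by
  induction r with
  | zero =>
    intro i a j _ hf ha
    have ht : (shiftRight T i).head = D.bit false := by rw [shiftRight_head]; exact hf
    have hne : D.bit false ≠ D.bit true := fun h => Bool.false_ne_true (D.bit_injective h)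
    refine ⟨0, 1, by omega, by omega, by omega,
      Reach.one ((step_cfg (by simp) _ _ _ _ rfl).trans ?_)⟩
    have := act_head_some Turing.Dir.left (shiftRight T i)
    rw [ht] at this
    simp [program, CounterOp.apply, ht, hne, this]
  | succ r ih =>
    intro i a j hT hf ha
    rw [show i + (r + 1) = i + 1 + r by omega] at hT hf ⊢
    have hi : T.nth (i : ℤ) = D.bit true := hT i (by omega)
    by_cases hj : j = 0
    · subst hj
      have hlast : Fin.last c ≠ 0 := by
        intro h
        exact hc (by simpa using congrArg Fin.val h)
      have hv := Fin.val_sub_one_of_ne_zero hlast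
      rw [Fin.val_last] at hv
      obtain ⟨m, s, h1, h2, h3, h4⟩ := ih (i + 1) (2 * a) (Fin.last c - 1) hT hf (by omega)
      have e : 2 * a * 2 ^ m = a * 2 ^ (m + 1) := by ring
      rw [e] at h3 h4
      refine ⟨m + 1, s + 1 + (4 * a + 3), ?_, ?_, by omega,
        (reach_scan_last ?_ a).trans ((reach_scan_one hi hlast _).trans h4)⟩
      · rw [Nat.mul_add, Fin.val_zero]
        omega
      · rw [Nat.mul_add, Fin.val_zero]
        omega
      · rw [shiftRight_head, hi]
    · have hv := Fin.val_sub_one_of_ne_zero hj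
      have hj' : (j : ℕ) ≠ 0 := fun h => hj (Fin.ext h)
      obtain ⟨m, s, h1, h2, h3, h4⟩ := ih (i + 1) a (j - 1) hT hf ha
      exact ⟨m, s + 1, by omega, by omega, by omega, (reach_scan_one hi hj a).trans h4⟩

/-- The head crosses only ones on its way left, so the first blank is the cell just before the
input; it becomes the separator between padding and formula. -/
theorem reach_fill_of_back (w : List D.Symbol) (i a : ℕ)
    (hT : ∀ v < i, (Turing.Tape.mk₁ w).nth (v : ℤ) = D.bit true) :
    Reach o (i + 1)
      (cfg (c := c) (Sum.inl back) ((shiftRight (Turing.Tape.mk₁ w) i).move Turing.Dir.left) a 0)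
      (cfg (Sum.inl fill) (Turing.Tape.mk' (Turing.ListBlank.mk [])
        (Turing.ListBlank.mk (default :: D.bit true :: w))) a 0) := by
  induction i with
  | zero =>
    have ht : (shiftRight (Turing.Tape.mk₁ w) 0).move Turing.Dir.left =
        Turing.Tape.mk' (Turing.ListBlank.mk []) (Turing.ListBlank.mk (default :: w)) := by
      simp [shiftRight, Turing.Tape.mk₁, Turing.Tape.mk₂, Turing.Tape.move_left_mk']
    rw [ht]
    refine Reach.one ((step_cfg (by simp) _ _ _ _ rfl).trans ?_)
    simp [program, CounterOp.apply, MultiTapeTM.act, Turing.Tape.write_mk',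
      Turing.Tape.move_left_mk']
  | succ i ih =>
    rw [shiftRight_succ, Turing.Tape.move_right_left]
    have ht : (shiftRight (Turing.Tape.mk₁ w) i).head = D.bit true := by
      rw [shiftRight_head, hT i (by omega)]
    have := act_head_some Turing.Dir.left (shiftRight (Turing.Tape.mk₁ w) i)
    rw [ht] at this
    refine Reach.head ((step_cfg (by simp) _ _ _ _ rfl).trans ?_)
      (ih fun v hv => hT v (by omega))
    simp [program, CounterOp.apply, ht, D.bit_ne_blank, this]

/-- The padding grows to the left, so the formula never has to be shifted, and the head ends on the
first symbol of the padded word. -/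
theorem reach_start_of_fill (w : List D.Symbol) (a : ℕ) :
    Reach o (a + 1)
      (cfg (c := c) (Sum.inl fill) (Turing.Tape.mk' (Turing.ListBlank.mk [])
        (Turing.ListBlank.mk (default :: w))) a 0)
      (cfg (Sum.inr D.start) (Turing.Tape.mk₁ (List.replicate a (D.bit false) ++ w)) 0 0) := by
  induction a generalizing w with
  | zero =>
    refine Reach.one ((step_cfg (by simp) _ _ _ _ rfl).trans ?_)
    -- The final move to the right leaves an explicit blank behind, to be identified with the empty
    -- half-tape.
    have hb : Turing.ListBlank.mk [(default : D.Symbol)] = Turing.ListBlank.mk [] :=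
      Quotient.sound' (Or.inr ⟨1, rfl⟩)
    simp [program, CounterOp.apply, MultiTapeTM.act, Turing.Tape.write_mk', Turing.Tape.move_right_mk', Turing.Tape.mk₁, Turing.Tape.mk₂, hb]
  | succ a ih =>
    rw [show List.replicate (a + 1) (D.bit false) ++ w =
      List.replicate a (D.bit false) ++ D.bit false :: w by
        rw [List.replicate_succ', List.append_assoc, List.singleton_append]]
    refine Reach.head ((step_cfg (by simp) _ _ _ _ rfl).trans ?_) (ih (D.bit false :: w))
    simp [program, CounterOp.apply, MultiTapeTM.act, Turing.Tape.write_mk',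
      Turing.Tape.move_left_mk']

theorem run_eq_cfg_start (hc : c ≠ 0) (φ : ThreeCNF) :
    ∃ m s, φ.numVars ≤ c * m ∧ c * m ≤ φ.numVars + c ∧ s ≤ 9 * 2 ^ m + 2 * φ.numVars + 4 ∧
      (machine c D).run o φ.encode s =
        cfg (Sum.inr D.start) (Turing.Tape.mk₁ ((Verifier.padded (2 ^ m) φ).map D.bit)) 0 0 := by
  set T := Turing.Tape.mk₁ (φ.encode.map D.bit) with hTdef
  have hnth : ∀ v : ℕ, T.nth (v : ℤ) = (φ.encode.map D.bit).getI v := by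
    intro v
    rw [hTdef, Turing.Tape.mk₁, Turing.Tape.mk₂, Turing.Tape.mk'_nth_nat, Turing.ListBlank.nth_mk]
  have hT : ∀ v < 0 + φ.numVars, T.nth (v : ℤ) = D.bit true := by
    intro v hv
    rw [Nat.zero_add] at hv
    rw [hnth, List.getI_eq_getElem _ (by simp [ThreeCNF.encode]; omega)]
    simp [ThreeCNF.encode, List.getElem_append_left, hv]
  have hF : T.nth ((0 + φ.numVars : ℕ) : ℤ) = D.bit false := by
    rw [Nat.zero_add, hnth, List.getI_eq_getElem _ (by simp [ThreeCNF.encode])]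
    simp [ThreeCNF.encode, List.getElem_append_right]
  obtain ⟨m, s, h1, h2, h3, h4⟩ := reach_back_of_scan (o := o) hc φ.numVars 0 1 0 hT hF le_rfl
  rw [Nat.one_mul] at h3 h4
  rw [Fin.val_zero] at h1 h2
  have h5 := (h4.trans (reach_fill_of_back _ _ _ hT)).trans (reach_start_of_fill _ _)
  -- The summands are the times for filling, walking back, scanning, and the initial `boot` step.
  refine ⟨m, 2 ^ m + 1 + (0 + φ.numVars + 1 + s) + 1, by omega, by omega, by omega, ?_⟩
  · rw [MultiTapeTM.run_add, run_one]
    refine Eq.trans h5 ?_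
    simp [Verifier.padded]

/-! #### The simulation phase -/

/-- A configuration of the solver that simulates a configuration of `D`. -/
def Simulates (k : (machine c D).Cfg) (d : D.Cfg) : Prop :=
  k.state = Sum.inr d.state ∧ ∀ i : Fin (D.extraTapes + 1), k.tape (innerTape D i) = d.tape i

/-- The machine `D` may possess query states, but a non-halting step that consumes no bit does not
start from one. The constant `false` supplied by the solver is then exactly what `D` receives. -/
theorem Simulates.step {k : (machine c D).Cfg} {d : D.Cfg} (h : Simulates k d) {o o' : ℕ → Bool}
    (hd : (D.step o' d).used ≤ d.used) :
    Simulates ((machine c D).step o k) (D.step o' d) := by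
  obtain ⟨hs, ht⟩ := h
  cases hv : D.verdict d.state with
  | some v =>
    have hv' : (machine c D).verdict k.state = some v := by rw [hs]; exact hv
    rw [(machine c D).step_of_verdict _ (by rw [hv']; exact Option.some_ne_none v),
      D.step_of_verdict _ (by rw [hv]; exact Option.some_ne_none v)]
    exact ⟨hs, ht⟩
  | none =>
    have hq : D.query d.state = false := by
      rw [MultiTapeTM.step, hv] at hd
      cases hq : D.query d.state with
      | false => rfl
      | true => simp [hq] at hd
    obtain ⟨q, tape, used⟩ := k
    obtain rfl : q = Sum.inr d.state := hs
    have htape : (fun i : Fin (D.extraTapes + 1) => (tape (innerTape D i)).head) =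
        fun i => (d.tape i).head := funext fun i => congrArg Turing.Tape.head (ht i)
    have hd' : D.step o' d =
        { state := (D.trans d.state (fun i => (d.tape i).head) false).1
          tape := fun i => MultiTapeTM.act
            ((D.trans d.state (fun i => (d.tape i).head) false).2 i) (d.tape i)
          used := d.used } := by
      rw [MultiTapeTM.step, hv]
      simp [hq]
    have hk : (machine c D).step o ⟨Sum.inr d.state, tape, used⟩ =
        { state := Sum.inr (D.trans d.state (fun i => (d.tape i).head) false).1
          tape := fun i => MultiTapeTM.act
            (if h : (i : ℕ) < D.extraTapes + 1 then
              (D.trans d.state (fun i => (d.tape i).head) false).2 ⟨i, h⟩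
            else ((tape i).head, none)) (tape i)
          used := used } := by
      have hv' : (machine c D).verdict (Sum.inr d.state) = none := hv
      rw [← htape, MultiTapeTM.step, hv']
      rfl
    rw [hd', hk]
    refine ⟨rfl, fun i => ?_⟩
    exact (congrArg (fun a => MultiTapeTM.act a (tape (innerTape D i))) (dif_pos i.2)).trans
      (congrArg _ (ht i))

theorem used_run_mono (M : MultiTapeTM) (b : ℕ → Bool) (x : List Bool) :
    Monotone fun t => (M.run b x t).used := by
  refine monotone_nat_of_le_succ fun t => ?_
  rw [M.run_succ, MultiTapeTM.step]
  cases M.verdict (M.run b x t).state with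
  | none => exact Nat.le_add_right _ _
  | some v => exact le_rfl

theorem simulates_start (x : List Bool) :
    Simulates (cfg (c := c) (Sum.inr D.start) (Turing.Tape.mk₁ (x.map D.bit)) 0 0) (D.init x) := by
  refine ⟨rfl, fun i => ?_⟩
  have h1 : (i : ℕ) ≠ D.extraTapes + 1 := by omega
  have h2 : (i : ℕ) ≠ D.extraTapes + 2 := by omega
  by_cases hi : i = 0
  · subst hi
    rfl
  · have h0 : (i : ℕ) ≠ 0 := fun h => hi (Fin.ext h)
    change tapes _ _ _ (innerTape D i) = _
    simp [tapes, innerTape, MultiTapeTM.init, h0, h1, h2, hi]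

theorem simulates_run {o o' : ℕ → Bool} {x : List Bool} {k : (machine c D).Cfg}
    (hk : Simulates k (D.init x)) {N : ℕ} (hN : (D.run o' x N).used ≤ 0) {t : ℕ} (ht : t ≤ N) :
    Simulates (((machine c D).step o)^[t] k) (D.run o' x t) := by
  induction t with
  | zero => exact hk
  | succ t ih =>
    rw [Function.iterate_succ_apply', D.run_succ]
    refine (ih (by omega)).step ?_
    rw [← D.run_succ]
    -- Consumption never decreases, so zero bits at time `N` means zero bits at every earlier time.
    have := used_run_mono D o' x ht
    dsimp only at this
    omega

/-- The solver gives the answer of `D` on a padded formula. -/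
theorem output_encode (hc : c ≠ 0) {T : ℕ → ℕ}
    (hD : ∀ x b, D.output b x (T x.length) ≠ none ∧ (D.run b x (T x.length)).used ≤ 0)
    (φ : ThreeCNF) (o : ℕ → Bool) :
    ∃ m, φ.numVars ≤ c * m ∧ c * m ≤ φ.numVars + c ∧
      ∀ t, 9 * 2 ^ m + 2 * φ.numVars + 4 + T (Verifier.padded (2 ^ m) φ).length ≤ t →
        ∀ b, (machine c D).output o φ.encode t =
          D.output b (Verifier.padded (2 ^ m) φ) (T (Verifier.padded (2 ^ m) φ).length) := by
  obtain ⟨m, s, h1, h2, h3, h4⟩ := run_eq_cfg_start (o := o) (D := D) hc φ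
  refine ⟨m, h1, h2, fun t ht b => ?_⟩
  set x := Verifier.padded (2 ^ m) φ
  have hsim : Simulates ((machine c D).run o φ.encode (T x.length + s))
      (D.run b x (T x.length)) := by
    rw [MultiTapeTM.run_add, h4]
    exact simulates_run (simulates_start x) (hD x b).2 le_rfl
  have hout : (machine c D).output o φ.encode (T x.length + s) = D.output b x (T x.length) := by
    rw [MultiTapeTM.output, hsim.1]
    rfl
  have hne : (machine c D).output o φ.encode (T x.length + s) ≠ none := by
    rw [hout]
    exact (hD x b).1
  rw [← hout, MultiTapeTM.output, MultiTapeTM.run_eq_of_verdict _ _ _ (by omega) hne,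
    MultiTapeTM.output]

end Solver

/-! ### The length of the code of a formula -/

/-- A list of length at most `k` is determined by its first `k` optional entries, that is, by a
function `Fin k → Option α`. -/
theorem card_le_of_nodup_of_length_le {α : Type} [Fintype α] {cs : List (List α)} {k : ℕ}
    (hcs : cs.Nodup) (hk : ∀ l ∈ cs, l.length ≤ k) :
    cs.length ≤ (Fintype.card α + 1) ^ k := by
  classical
  let f : List α → Fin k → Option α := fun l i => l[(i : ℕ)]?
  have hf : ∀ l ∈ cs, ∀ l' ∈ cs, f l = f l' → l = l' := by
    intro l hl l' hl' h
    refine List.ext_getElem? fun i => ?_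
    by_cases hi : i < k
    · exact congrFun h ⟨i, hi⟩
    · have h1 := hk l hl
      have h2 := hk l' hl'
      rw [List.getElem?_eq_none (by omega), List.getElem?_eq_none (by omega)]
  have h := (List.Nodup.map_on hf hcs).length_le_card
  simpa [Fintype.card_option] using h

theorem ThreeCNF.length_encodeClause_le {n : ℕ} {ls : List (Fin n × Bool)} (h : ls.length ≤ 3) :
    (ThreeCNF.encodeClause ls).length ≤ 3 * (n + 3) + 1 := by
  have h1 : (ls.flatMap ThreeCNF.encodeLiteral).length ≤ ls.length * (n + 3) := by
    clear h
    induction ls with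
    | nil => simp
    | cons l ls ih =>
      have := l.1.isLt
      simp only [List.flatMap_cons, List.length_append, List.length_cons, Nat.add_mul]
      simp only [ThreeCNF.encodeLiteral, List.length_append, List.length_cons,
        List.length_replicate, List.length_nil]
      omega
  have h2 : ls.length * (n + 3) ≤ 3 * (n + 3) := Nat.mul_le_mul_right _ h
  simp only [ThreeCNF.encodeClause, List.length_append, List.length_cons, List.length_nil]
  omega

/-- Distinctness leaves at most cubically many clauses, each with a code of linear length; hence
degree four. -/
theorem ThreeCNF.length_encode_le (φ : ThreeCNF) :
    φ.encode.length ≤ 120 * (φ.numVars + 1) ^ 4 := by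
  set n := φ.numVars with hn
  have h1 : φ.clauses.length ≤ (n * 2 + 1) ^ 3 := by
    simpa using card_le_of_nodup_of_length_le φ.distinct φ.width_le
  have h2 : (φ.clauses.flatMap ThreeCNF.encodeClause).length ≤
      φ.clauses.length * (3 * (n + 3) + 1) := by
    rw [List.length_flatMap]
    refine (List.sum_le_card_nsmul _ (3 * (n + 3) + 1) ?_).trans (by simp)
    intro k hk
    obtain ⟨ls, hls, rfl⟩ := List.mem_map.1 hk
    exact ThreeCNF.length_encodeClause_le (φ.width_le ls hls)
  have h3 := h2.trans (Nat.mul_le_mul_right _ h1)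
  have h4 : φ.encode.length = n + 1 + (φ.clauses.flatMap ThreeCNF.encodeClause).length := by
    simp [ThreeCNF.encode, hn]
    omega
  have h5 : (n * 2 + 1) ^ 3 * (3 * (n + 3) + 1) ≤ (2 * (n + 1)) ^ 3 * (10 * (n + 1)) :=
    Nat.mul_le_mul (Nat.pow_le_pow_left (by omega) 3) (by omega)
  have h6 : n + 1 ≤ (n + 1) ^ 4 := Nat.le_self_pow (by omega) _
  have h7 : (2 * (n + 1)) ^ 3 * (10 * (n + 1)) = 80 * (n + 1) ^ 4 := by ring
  omega

/-! ### Time bounds -/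

/-- The additive constant absorbs the finitely many lengths below the asymptotic threshold; the
solver needs a bound for every padded word. -/
theorem exists_linear_bound {T : ℕ → ℕ}
    (hT : (fun n => (T n : ℝ)) =O[atTop] fun n : ℕ => (n : ℝ)) :
    ∃ C C' : ℕ, ∀ n, T n ≤ C * n + C' := by
  obtain ⟨r, hr⟩ := hT.bound
  obtain ⟨N, hN⟩ := eventually_atTop.1 hr
  refine ⟨⌈r⌉₊, ∑ i ∈ Finset.range N, T i, fun n => ?_⟩
  rcases lt_or_ge n N with h | h
  · exact (Finset.single_le_sum (fun i _ => Nat.zero_le (T i)) (Finset.mem_range.2 h)).trans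
      (Nat.le_add_left _ _)
  · refine le_trans ?_ (Nat.le_add_right _ _)
    have h1 := hN n h
    rw [Real.norm_of_nonneg (Nat.cast_nonneg _), Real.norm_of_nonneg (Nat.cast_nonneg _)] at h1
    have h2 : (T n : ℝ) ≤ (⌈r⌉₊ : ℝ) * n :=
      h1.trans (mul_le_mul_of_nonneg_right (Nat.le_ceil r) (Nat.cast_nonneg n))
    exact_mod_cast h2

theorem isBigO_succ_pow_four {δ : ℝ} (hδ : 0 < δ) :
    (fun l : ℕ => ((l : ℝ) + 1) ^ 4) =O[atTop] fun l : ℕ => (2 : ℝ) ^ (δ * (l : ℝ)) := by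
  have h1 : (fun l : ℕ => ((l : ℝ) + 1) ^ 4) =O[atTop] fun l : ℕ => (l : ℝ) ^ 4 := by
    refine IsBigO.pow (IsBigO.of_bound 2 ((eventually_ge_atTop 1).mono fun n hn => ?_)) 4
    have hn' : (1 : ℝ) ≤ n := by exact_mod_cast hn
    rw [Real.norm_of_nonneg (by positivity), Real.norm_of_nonneg (by positivity)]
    linarith
  have h2 := (isLittleO_pow_exp_pos_mul_atTop 4 (mul_pos (Real.log_pos one_lt_two) hδ)).isBigO
  refine h1.trans ((h2.comp_tendsto tendsto_natCast_atTop_atTop).congr_right fun l => ?_)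
  rw [Function.comp_apply, Real.rpow_def_of_pos two_pos, mul_assoc]

theorem isBigO_two_pow_div {δ : ℝ} {c : ℕ} (hc : 1 / (c : ℝ) ≤ δ) :
    (fun l : ℕ => (2 : ℝ) ^ (l / c + 1)) =O[atTop] fun l : ℕ => (2 : ℝ) ^ (δ * (l : ℝ)) := by
  refine IsBigO.of_bound 2 (Eventually.of_forall fun l => ?_)
  rw [Real.norm_of_nonneg (by positivity), Real.norm_of_nonneg (by positivity), pow_succ',
    ← Real.rpow_natCast]
  refine mul_le_mul_of_nonneg_left (Real.rpow_le_rpow_of_exponent_le one_le_two ?_) two_pos.le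
  refine Nat.cast_div_le.trans ?_
  rw [div_eq_mul_one_div, mul_comm]
  exact mul_le_mul_of_nonneg_right hc (Nat.cast_nonneg l)

/-- The time bound of the solver has to depend on the number of variables alone, so `m` is replaced
by `n / c + 1` and the length of the code by its polynomial bound. -/
theorem solvableInTime_of_language_mem_DTIME {δ : ℝ} (hδ : 0 < δ) {c : ℕ} (hc : c ≠ 0)
    (hcδ : 1 / (c : ℝ) ≤ δ) (h : Verifier.language c ∈ DTIME (fun n => (n : ℝ))) :
    ThreeCNF.SolvableInTime (fun l => (2 : ℝ) ^ (δ * (l : ℝ))) := by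
  obtain ⟨D, T, hT, hD, hL⟩ := h
  obtain ⟨C, C', hC⟩ := exists_linear_bound hT
  refine ⟨Solver.machine c D, fun l => (9 + C) * 2 ^ (l / c + 1) +
    (6 + 121 * C + C') * (l + 1) ^ 4, fun _ => rfl, ?_, fun φ => ?_⟩
  · push_cast
    exact ((isBigO_two_pow_div hcδ).const_mul_left _).add
      ((isBigO_succ_pow_four hδ).const_mul_left _)
  · obtain ⟨m, h1, h2, h3⟩ := Solver.output_encode hc hD φ (fun _ => false)
    set x := Verifier.padded (2 ^ m) φ with hx
    set n := φ.numVars with hn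
    have hm : m ≤ n / c + 1 := by
      rw [← Nat.add_div_right _ (Nat.pos_of_ne_zero hc),
        Nat.le_div_iff_mul_le (Nat.pos_of_ne_zero hc), mul_comm]
      exact h2
    have hP : 2 ^ m ≤ 2 ^ (n / c + 1) := Nat.pow_le_pow_right two_pos hm
    have hlen : x.length ≤ 2 ^ m + 121 * (n + 1) ^ 4 := by
      have h4 : φ.encode.length ≤ 120 * (n + 1) ^ 4 := φ.length_encode_le
      have h5 : 1 ≤ (n + 1) ^ 4 := Nat.one_le_pow _ _ (by omega)
      simp only [hx, Verifier.padded, List.length_append, List.length_replicate, List.length_cons]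
      omega
    have htime : 9 * 2 ^ m + 2 * n + 4 + T x.length ≤
        (9 + C) * 2 ^ (n / c + 1) + (6 + 121 * C + C') * (n + 1) ^ 4 := by
      have h4 := hC x.length
      have h5 : C * x.length ≤ C * (2 ^ (n / c + 1) + 121 * (n + 1) ^ 4) :=
        Nat.mul_le_mul_left _ (by omega)
      have h6 : n + 1 ≤ (n + 1) ^ 4 := Nat.le_self_pow (by omega) _
      have h7 : C' ≤ C' * (n + 1) ^ 4 := Nat.le_mul_of_pos_right _ (by positivity)
      nlinarith
    have hout := h3 _ htime
    obtain ⟨r, hr⟩ := Option.ne_none_iff_exists'.1 (hD x (fun _ => false)).1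
    refine ⟨r, (hout _).trans hr, ?_⟩
    rw [← Verifier.padded_mem_language hc φ h1, hL]
    constructor
    · rintro rfl
      exact ⟨_, hr⟩
    · rintro ⟨b, hb⟩
      -- The output of the solver equals that of `D` for every oracle, so the answer of `D` does not
      -- depend on the oracle.
      rw [← hx, ← hout b, hout (fun _ => false), hr] at hb
      exact Option.some_injective _ hb

/-! ### Conclusion -/

theorem mainTheorem6 (hETH : ExponentialTimeHypothesis) :
    ∃ k : ℝ, 0 < k ∧
      ¬ NDTIME (fun n => ⌈k * Real.logb 2 (n : ℝ)⌉₊) (fun n => (n : ℝ)) ⊆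
        DTIME (fun n => (n : ℝ)) := by
  obtain ⟨δ, hδ, hns⟩ := hETH
  obtain ⟨c, hc⟩ := exists_nat_one_div_lt hδ
  -- The number of guesses per halving is `c + 1`, which is positive and satisfies `1 / (c + 1) <
  -- δ`.
  refine ⟨((c + 1 : ℕ) : ℝ), by positivity, fun hsub => hns ?_⟩
  exact solvableInTime_of_language_mem_DTIME hδ c.succ_ne_zero (by exact_mod_cast hc.le)
    (hsub (Verifier.language_mem_NDTIME c.succ_ne_zero))
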